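/- Let $N\ge 3$ and let $\rho\in(0,1)$ be the unique root in $(0,1)$ of $\rho^{2N}(2N\rho+2N+1)=1$. Put $\alpha=1+\rho$, $q=\rho^N$, $R=q^2$. For $d=(d_0,\dots,d_{N-2})\in\mathbb R^{N-1}$ (empty sums are $0$) define $c_0,\dots,c_N$ by \[ c_i=R\Big(\alpha\sum_{k=0}^i d_k-d_i+\alpha\Big)\ (0\le i\le N-2),\qquad c_{N-1}=R\Big(1+\sum_{k=0}^{N-2}d_k+\frac{\rho}{q}\Big),\qquad c_N=q, \] then $a_0,\dots,a_{N-1}$ and $b_0,\dots,b_{N-2}$ by \[ a_{N-1}=1-c_N\Big(1+\sum_{k=0}^{N-2}d_k\Big), \] \[ a_{N-2}=\frac1\alpha\Big[\frac{c_{N-1}^2}{R}+\frac{c_{N-2}c_{N-1}}{R}-a_{N-1}-(1+\alpha)c_{N-1}\Big(1+\sum_{k=0}^{N-3}d_k\Big)\Big], \] \[ b_{N-2}=\frac1\alpha\Big[\frac{\rho c_{N-1}^2}{R}-\frac{c_{N-2}c_{N-1}}{R}-\rho a_{N-1}+c_{N-1}\Big(1+\sum_{k=0}^{N-3}d_k\Big)\Big],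 \] and, for $i=N-3,\dots,0$, \[ a_i=\frac1\alpha\Big[\frac{c_{i+1}^2}{R}+\frac{c_ic_{i+1}}{R}-a_{i+1}-(1+\alpha)c_{i+1}\Big(1+\sum_{k=0}^{i-1}d_k\Big)-d_{i+1}\sum_{j=i+3}^N c_j+(2\alpha-1)b_{i+1}\Big], \] \[ b_i=\frac1\alpha\Big[\frac{\rho c_{i+1}^2}{R}-\frac{c_ic_{i+1}}{R}-\rho a_{i+1}+c_{i+1}\Big(1+\sum_{k=0}^{i-1}d_k\Big)-\rho d_{i+1}\sum_{j=i+3}^N c_j+\rho(2\alpha-1)b_{i+1}\Big]. \] Finally let \[ \varepsilon_0=a_0+d_0\sum_{j=2}^N c_j-b_0-c_0, \] \[ \varepsilon_i=b_{i-1}+a_i+d_i\sum_{j=i+2}^N c_j-a_{i-1}-b_i-c_i\Big(1+\sum_{k=0}^{i-2}d_k\Big)\qquad(1\le i\le N-2), \] and $E_N(d)=(\varepsilon_0(d),\dots,\varepsilon_{N-2}(d))$. Then there is $d^\star\in\mathbb R^{N-1}$ with $E_N(d^\star)=0$, with $d^\star_i>0$ for all $0\le i\le N-2$, and with $\sum_{i=0}^{N-2}d^\star_i<2N$;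 that is, the reduced system has a zero in the interior of the simplex $\{d\ge 0,\ \sum_i d_i\le 2N\}$. -/

import Mathlib

namespace GSW

/-- `ρ` lies in `(0,1)` and satisfies `ρ^(2N) (2Nρ + 2N + 1) = 1`. -/
def IsBalancedRoot (N : ℕ) (ρ : ℝ) : Prop :=
  0 < ρ ∧ ρ < 1 ∧ ρ ^ (2 * N) * (2 * (N : ℝ) * ρ + 2 * (N : ℝ) + 1) = 1

theorem existsUnique_isBalancedRoot (N : ℕ) (hN : 1 ≤ N) : ∃! ρ : ℝ, IsBalancedRoot N ρ := by
  have hN' : (1 : ℝ) ≤ N := by exact_mod_cast hN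
  have hmono : StrictMonoOn
      (fun x : ℝ => x ^ (2 * N) * (2 * (N : ℝ) * x + 2 * (N : ℝ) + 1)) (Set.Ici 0) := by
    intro x hx y hy hxy
    have hx0 : (0 : ℝ) ≤ x := hx
    have h1 : x ^ (2 * N) < y ^ (2 * N) := pow_lt_pow_left₀ hxy hx0 (by omega)
    have h2 : 2 * (N : ℝ) * x + 2 * (N : ℝ) + 1 ≤ 2 * (N : ℝ) * y + 2 * (N : ℝ) + 1 := by
      nlinarith
    have h3 : 0 < 2 * (N : ℝ) * x + 2 * (N : ℝ) + 1 := by positivity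
    have h4 : 0 ≤ y ^ (2 * N) := pow_nonneg (hx0.trans hxy.le) _
    exact mul_lt_mul h1 h2 h3 h4
  have hcont : ContinuousOn
      (fun x : ℝ => x ^ (2 * N) * (2 * (N : ℝ) * x + 2 * (N : ℝ) + 1)) (Set.Icc 0 1) := by
    fun_prop
  have hmem : (1 : ℝ) ∈ Set.Ioo
      ((0 : ℝ) ^ (2 * N) * (2 * (N : ℝ) * 0 + 2 * (N : ℝ) + 1))
      ((1 : ℝ) ^ (2 * N) * (2 * (N : ℝ) * 1 + 2 * (N : ℝ) + 1)) := by
    rw [zero_pow (by omega), one_pow]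
    constructor <;> linarith
  obtain ⟨ρ, ⟨h0, h1⟩, h⟩ := intermediate_value_Ioo (zero_le_one' ℝ) hcont hmem
  refine ⟨ρ, ⟨h0, h1, h⟩, ?_⟩
  rintro y ⟨hy0, hy1, hy⟩
  exact hmono.injOn hy0.le h0.le (hy.trans h.symm)

open Classical in
/-- The unique root `ρ_N ∈ (0,1)` of `ρ^(2N) (2Nρ + 2N + 1) = 1` (for `N ≥ 1`; the value for
`N = 0` is irrelevant). -/
noncomputable def balancedRoot (N : ℕ) : ℝ :=
  if h : ∃ ρ : ℝ, IsBalancedRoot N ρ then h.choose else 0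

theorem isBalancedRoot_balancedRoot (N : ℕ) (hN : 1 ≤ N) :
    IsBalancedRoot N (balancedRoot N) := by
  have h := (existsUnique_isBalancedRoot N hN).exists
  rw [balancedRoot, dif_pos h]
  exact h.choose_spec

/-- System C: the coefficients `c_0, …, c_N`, where `q = ρ^N`, `R = q^2 = ρ^(2N)`, `α = 1 + ρ`.
The sequence `d` is only read at the indices `0, …, N - 2`. -/
noncomputable def coeffC (N : ℕ) (ρ : ℝ) (d : ℕ → ℝ) (i : ℕ) : ℝ :=
  if i + 2 ≤ N then
    ρ ^ (2 * N) * ((1 + ρ) * (∑ k ∈ Finset.range (i + 1), d k) - d i + (1 + ρ))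
  else if i + 1 = N then
    ρ ^ (2 * N) * (1 + (∑ k ∈ Finset.range (N - 1), d k) + ρ / ρ ^ N)
  else if i = N then ρ ^ N
  else 0

/-- The terminal coefficient `a_{N-1}` of System A. -/
noncomputable def coeffATerminal (N : ℕ) (ρ : ℝ) (d : ℕ → ℝ) : ℝ :=
  1 - coeffC N ρ d N * (1 + ∑ k ∈ Finset.range (N - 1), d k)

/-- The backward recursion of Systems A and B: `coeffAB N ρ d m = (a_i, b_i)` with
`i = N - 2 - m`, for `m = 0, …, N - 2`. -/
noncomputable def coeffAB (N : ℕ) (ρ : ℝ) (d : ℕ → ℝ) : ℕ → ℝ × ℝ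
  | 0 =>
    let R : ℝ := ρ ^ (2 * N)
    let α : ℝ := 1 + ρ
    let c : ℕ → ℝ := coeffC N ρ d
    ( (c (N - 1) ^ 2 / R + c (N - 2) * c (N - 1) / R - coeffATerminal N ρ d
        - (1 + α) * c (N - 1) * (1 + ∑ k ∈ Finset.range (N - 2), d k)) / α,
      (ρ * c (N - 1) ^ 2 / R - c (N - 2) * c (N - 1) / R - ρ * coeffATerminal N ρ d
        + c (N - 1) * (1 + ∑ k ∈ Finset.range (N - 2), d k)) / α )
  | m + 1 =>
    let R : ℝ := ρ ^ (2 * N)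
    let α : ℝ := 1 + ρ
    let c : ℕ → ℝ := coeffC N ρ d
    let i : ℕ := N - 3 - m
    let a' : ℝ := (coeffAB N ρ d m).1
    let b' : ℝ := (coeffAB N ρ d m).2
    ( (c (i + 1) ^ 2 / R + c i * c (i + 1) / R - a'
        - (1 + α) * c (i + 1) * (1 + ∑ k ∈ Finset.range i, d k)
        - d (i + 1) * (∑ j ∈ Finset.Icc (i + 3) N, c j)
        + (2 * α - 1) * b') / α,
      (ρ * c (i + 1) ^ 2 / R - c i * c (i + 1) / R - ρ * a'
        + c (i + 1) * (1 + ∑ k ∈ Finset.range i, d k)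
        - ρ * d (i + 1) * (∑ j ∈ Finset.Icc (i + 3) N, c j)
        + ρ * (2 * α - 1) * b') / α )

/-- The coefficients `a_0, …, a_{N-1}` generated by System A. -/
noncomputable def coeffA (N : ℕ) (ρ : ℝ) (d : ℕ → ℝ) (i : ℕ) : ℝ :=
  if i + 1 = N then coeffATerminal N ρ d else (coeffAB N ρ d (N - 2 - i)).1

/-- The coefficients `b_0, …, b_{N-2}` generated by System B. -/
noncomputable def coeffB (N : ℕ) (ρ : ℝ) (d : ℕ → ℝ) (i : ℕ) : ℝ :=
  (coeffAB N ρ d (N - 2 - i)).2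

/-- The recursion for `a_i`, `0 ≤ i ≤ N - 3`, in the usual indexing. -/
theorem coeffA_rec (N : ℕ) (ρ : ℝ) (d : ℕ → ℝ) (i : ℕ) (hi : i + 3 ≤ N) :
    coeffA N ρ d i =
      (coeffC N ρ d (i + 1) ^ 2 / ρ ^ (2 * N)
        + coeffC N ρ d i * coeffC N ρ d (i + 1) / ρ ^ (2 * N) - coeffA N ρ d (i + 1)
        - (1 + (1 + ρ)) * coeffC N ρ d (i + 1) * (1 + ∑ k ∈ Finset.range i, d k)
        - d (i + 1) * (∑ j ∈ Finset.Icc (i + 3) N, coeffC N ρ d j)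
        + (2 * (1 + ρ) - 1) * coeffB N ρ d (i + 1)) / (1 + ρ) := by
  obtain ⟨m, rfl⟩ : ∃ m, N = i + 3 + m := ⟨N - (i + 3), by omega⟩
  have h1 : i + 3 + m - 2 - i = m + 1 := by omega
  have h2 : i + 3 + m - 2 - (i + 1) = m := by omega
  have h3 : i + 3 + m - 3 - m = i := by omega
  rw [coeffA, if_neg (by omega), coeffA, if_neg (by omega), coeffB, h1, h2, coeffAB]
  simp only [h3]

/-- The recursion for `b_i`, `0 ≤ i ≤ N - 3`, in the usual indexing. -/
theorem coeffB_rec (N : ℕ) (ρ : ℝ) (d : ℕ → ℝ) (i : ℕ) (hi : i + 3 ≤ N) :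
    coeffB N ρ d i =
      (ρ * coeffC N ρ d (i + 1) ^ 2 / ρ ^ (2 * N)
        - coeffC N ρ d i * coeffC N ρ d (i + 1) / ρ ^ (2 * N) - ρ * coeffA N ρ d (i + 1)
        + coeffC N ρ d (i + 1) * (1 + ∑ k ∈ Finset.range i, d k)
        - ρ * d (i + 1) * (∑ j ∈ Finset.Icc (i + 3) N, coeffC N ρ d j)
        + ρ * (2 * (1 + ρ) - 1) * coeffB N ρ d (i + 1)) / (1 + ρ) := by
  obtain ⟨m, rfl⟩ : ∃ m, N = i + 3 + m := ⟨N - (i + 3), by omega⟩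
  have h1 : i + 3 + m - 2 - i = m + 1 := by omega
  have h2 : i + 3 + m - 2 - (i + 1) = m := by omega
  have h3 : i + 3 + m - 3 - m = i := by omega
  rw [coeffB, coeffA, if_neg (by omega), coeffB, h1, h2, coeffAB]
  simp only [h3]

/-- System D: the residuals `ε_0, …, ε_{N-2}`. -/
noncomputable def residual (N : ℕ) (ρ : ℝ) (d : ℕ → ℝ) (i : ℕ) : ℝ :=
  if i = 0 then
    coeffA N ρ d 0 + d 0 * (∑ j ∈ Finset.Icc 2 N, coeffC N ρ d j)
      - coeffB N ρ d 0 - coeffC N ρ d 0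
  else
    coeffB N ρ d (i - 1) + coeffA N ρ d i + d i * (∑ j ∈ Finset.Icc (i + 2) N, coeffC N ρ d j)
      - coeffA N ρ d (i - 1) - coeffB N ρ d i
      - coeffC N ρ d i * (1 + ∑ k ∈ Finset.range (i - 1), d k)

/-- The sequence `d_0, …, d_{n-1}, 0, 0, …`. -/
def extendZero {n : ℕ} (d : Fin n → ℝ) (k : ℕ) : ℝ :=
  if h : k < n then d ⟨k, h⟩ else 0

/-- The reduced residual map `E_N(d) = (ε_0(d), …, ε_{N-2}(d))` at `ρ = ρ_N`. -/
noncomputable def reducedResidual (N : ℕ) (d : Fin (N - 1) → ℝ) : Fin (N - 1) → ℝ :=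
  fun i => residual N (balancedRoot N) (extendZero d) (i : ℕ)

end GSW

/-!
The reduced system has an explicit solution. Write `q = ρ ^ N`, `α = 1 + ρ`, and pass from the
increments `d` to the scaled partial sums `s i = q (1 + d 0 + ⋯ + d (i - 1))`, completed by
`s N = 1`. Then `c_i = q (s i + ρ s (i + 1))` for `i < N`, and the linear combination `ρ a - b` of
Systems A and B eliminates one unknown: `b_i = ρ X i` and
`a_i = X i + (s (i + 1) + ρ s (i + 2)) (s (i + 1) - s i)` for a single sequence `X` satisfying a
first-order recursion, in terms of which the residuals are short
(`IsReducedSolution.residual_eq_zero`). Vanishing of the residuals turns the recursion into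
`X (i - 1) + (s i) ^ 2 / 2 = ρ ^ 2 (X i + (s (i + 1)) ^ 2 / 2)`, and summing the residuals gives a
formula for the product of `s i` with the tail sum of the `c_j`. The resulting quadratic recursion
for `s` integrates: with
`φ n = 2 α n - 1 + ρ ^ (2 n)` and `r n = √(φ n)`,
`s i = (r (N - i + 1) - r (N - i)) / α` for `1 ≤ i ≤ N`.
The remaining condition `s 0 = q` is `r N = 1 / q - q`, which is the defining equation of `ρ`
(`IsBalancedRoot.pow_mul_root`). That this `s` solves the system is then a polynomial identity in
consecutive values of `r` (`isReducedSolution_profile`).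

Positivity of the increments is strict monotonicity of `s` (`profile_lt_succ`). For `i ≥ 1` it is
strict concavity of `r` (`root_concave`), and `s 0 < s 1` is a direct estimate; both use
`ρ > 1 / 2`.
Finally `s (N - 1) < s N = 1` bounds the sum of the increments by `1 / q - 1 < 2 N`.
-/

namespace GSW

/-! ### The system in terms of partial sums -/

/-- Data `s`, `T`, `X` that trivialize Systems A–D for the increments `d`. With `q = ρ ^ N`:
`s i = q (1 + d 0 + ⋯ + d (i - 1))` for `i < N`, completed by `s N = 1`; `q * T i` is the tail
sum `c_i + ⋯ + c_N`; and `ρ * X i` is the coefficient `b_i`, completed by `X (N - 1) = 0`.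
The last two fields say that the residuals vanish. -/
structure IsReducedSolution (N : ℕ) (ρ : ℝ) (d s T X : ℕ → ℝ) : Prop where
  s_zero : s 0 = ρ ^ N
  s_top : s N = 1
  s_step : ∀ k, k + 2 ≤ N → ρ ^ N * d k = s (k + 1) - s k
  T_top : T N = 1
  T_step : ∀ i, 1 ≤ i → i < N → T i = s i + ρ * s (i + 1) + T (i + 1)
  X_top : X (N - 1) = 0
  X_step : ∀ i, i + 2 ≤ N → (1 + ρ) * X i = (1 + ρ) * (2 * ρ - 1) * X (i + 1)
    + ρ * (s (i + 1) + ρ * s (i + 2)) * s (i + 2) - (s (i + 2) - s (i + 1)) * T (i + 2)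
  balance_zero : (1 - ρ) * X 0 + (s 1 - s 0) * T 1 = (s 0 + ρ * s 1) * s 0
  balance_succ : ∀ i, i + 3 ≤ N → (1 - ρ) * (X (i + 1) - X i)
    + (s (i + 2) - s (i + 1)) * T (i + 2) = (s (i + 1) + ρ * s (i + 2)) * s (i + 1)

namespace IsReducedSolution

variable {N : ℕ} {ρ : ℝ} {d s T X : ℕ → ℝ}

theorem sum_range (h : IsReducedSolution N ρ d s T X) (i : ℕ) (hi : i < N) :
    ρ ^ N * (1 + ∑ k ∈ Finset.range i, d k) = s i := by
  induction i with
  | zero => simp [h.s_zero]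
  | succ i ih =>
    rw [Finset.sum_range_succ]
    linear_combination ih (by omega) + h.s_step i (by omega)

theorem coeffC_eq (h : IsReducedSolution N ρ d s T X) (hρ : 0 < ρ) (i : ℕ) (hi : i < N) :
    coeffC N ρ d i = ρ ^ N * (s i + ρ * s (i + 1)) := by
  have hq : ρ ^ N ≠ 0 := (pow_pos hρ N).ne'
  rw [coeffC]
  split_ifs with h1 h2 h3
  · have h4 := h.sum_range (i + 1) (by omega)
    have h5 := h.s_step i h1
    rw [two_mul, pow_add]
    linear_combination ρ ^ N * (1 + ρ) * h4 - ρ ^ N * h5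
  · have h4 := h.sum_range i hi
    have h5 := h.s_top
    obtain rfl : N = i + 1 := h2.symm
    rw [two_mul, pow_add, Nat.add_sub_cancel, h5]
    field_simp
    linear_combination h4
  · omega
  · omega

theorem coeffC_top (N : ℕ) (ρ : ℝ) (d : ℕ → ℝ) : coeffC N ρ d N = ρ ^ N := by
  simp [coeffC]

theorem sum_tail (h : IsReducedSolution N ρ d s T X) (hρ : 0 < ρ) (i : ℕ) (hi : 1 ≤ i)
    (hiN : i ≤ N) : ∑ j ∈ Finset.Icc i N, coeffC N ρ d j = ρ ^ N * T i := by
  induction hiN using Nat.decreasingInduction with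
  | self => simp [coeffC_top, h.T_top]
  | of_succ i hiN ih =>
    have hs : Finset.Icc i N = insert i (Finset.Icc (i + 1) N) := by
      ext x; simp only [Finset.mem_Icc, Finset.mem_insert]; omega
    rw [hs, Finset.sum_insert (by simp), ih (by omega), h.coeffC_eq hρ i hiN, h.T_step i hi hiN]
    ring

theorem coeffAB_eq (h : IsReducedSolution N ρ d s T X) (hρ : 0 < ρ) (m i : ℕ)
    (hi : i + 2 + m = N) :
    coeffAB N ρ d m =
      (X i + (s (i + 1) + ρ * s (i + 2)) * (s (i + 1) - s i), ρ * X i) := by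
  have hq : ρ ^ N ≠ 0 := (pow_pos hρ N).ne'
  have hα : 1 + ρ ≠ 0 := by positivity
  have hR : ρ ^ (2 * N) = (ρ ^ N) ^ 2 := by rw [mul_comm, pow_mul]
  have hsum : ∀ k < N, 1 + ∑ k ∈ Finset.range k, d k = s k / ρ ^ N := fun k hk => by
    rw [eq_div_iff hq, ← h.sum_range k hk, mul_comm]
  induction m generalizing i with
  | zero =>
    have hX := h.X_step i (by omega)
    have hs : s (i + 2) = 1 := by rw [show i + 2 = N from hi, h.s_top]
    have hT : T (i + 2) = 1 := by rw [show i + 2 = N from hi, h.T_top]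
    have hX0 : X (i + 1) = 0 := by rw [show i + 1 = N - 1 by omega, h.X_top]
    simp only [coeffAB, coeffATerminal, coeffC_top,
      show N - 1 = i + 1 by omega, show N - 2 = i by omega, hsum i (by omega),
      hsum (i + 1) (by omega), h.coeffC_eq hρ i (by omega), h.coeffC_eq hρ (i + 1) (by omega), hs,
      hR, Prod.mk.injEq]
    rw [hs, hT, hX0] at hX
    constructor
    · field_simp
      linear_combination -hX
    · field_simp
      linear_combination -ρ * hX
  | succ m ih =>
    have hX := h.X_step i (by omega)
    have hT := h.T_step (i + 2) (by omega) (by omega)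
    have hd : d (i + 1) = (s (i + 2) - s (i + 1)) / ρ ^ N := by
      rw [eq_div_iff hq, ← h.s_step (i + 1) (by omega), mul_comm]
    simp only [coeffAB, ih (i + 1) (by omega), show N - 3 - m = i by omega,
      h.sum_tail hρ (i + 3) (by omega) (by omega), hsum i (by omega), hd,
      h.coeffC_eq hρ i (by omega), h.coeffC_eq hρ (i + 1) (by omega), hR, Prod.mk.injEq]
    rw [hT] at hX
    constructor
    · field_simp
      linear_combination -hX
    · field_simp
      linear_combination -ρ * hX

theorem coeffA_eq (h : IsReducedSolution N ρ d s T X) (hρ : 0 < ρ) (i : ℕ) (hi : i + 2 ≤ N) :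
    coeffA N ρ d i = X i + (s (i + 1) + ρ * s (i + 2)) * (s (i + 1) - s i) := by
  rw [coeffA, if_neg (by omega), h.coeffAB_eq hρ (N - 2 - i) i (by omega)]

theorem coeffB_eq (h : IsReducedSolution N ρ d s T X) (hρ : 0 < ρ) (i : ℕ) (hi : i + 2 ≤ N) :
    coeffB N ρ d i = ρ * X i := by
  rw [coeffB, h.coeffAB_eq hρ (N - 2 - i) i (by omega)]

theorem residual_eq_zero (h : IsReducedSolution N ρ d s T X) (hρ : 0 < ρ) (i : ℕ)
    (hi : i + 2 ≤ N) : residual N ρ d i = 0 := by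
  have hq : ρ ^ N ≠ 0 := (pow_pos hρ N).ne'
  have hd : d i = (s (i + 1) - s i) / ρ ^ N := by
    rw [eq_div_iff hq, ← h.s_step i hi, mul_comm]
  rw [residual]
  cases i with
  | zero =>
    have hT := h.T_step 1 le_rfl (by omega)
    rw [if_pos rfl, h.coeffA_eq hρ 0 hi, h.coeffB_eq hρ 0 hi, h.coeffC_eq hρ 0 (by omega),
      h.sum_tail hρ 2 (by omega) hi, hd, div_mul_eq_mul_div, mul_left_comm,
      mul_div_cancel_left₀ _ hq, ← h.s_zero]
    linear_combination h.balance_zero - (s 1 - s 0) * hT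
  | succ i =>
    have hT := h.T_step (i + 2) (by omega) (by omega)
    have hsum : 1 + ∑ k ∈ Finset.range i, d k = s i / ρ ^ N := by
      rw [eq_div_iff hq, ← h.sum_range i (by omega), mul_comm]
    rw [if_neg (by omega), Nat.add_sub_cancel, h.coeffA_eq hρ (i + 1) hi,
      h.coeffB_eq hρ (i + 1) hi, h.coeffA_eq hρ i (by omega), h.coeffB_eq hρ i (by omega),
      h.coeffC_eq hρ (i + 1) (by omega), h.sum_tail hρ (i + 3) (by omega) hi, hd, hsum]
    field_simp
    linear_combination h.balance_succ i hi - (s (i + 2) - s (i + 1)) * hT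

end IsReducedSolution

/-! ### The radicands and their square roots -/

/-- The radicand `φ n = 2 (1 + ρ) n - 1 + ρ ^ (2 n)`; it vanishes at `n = 0`. -/
noncomputable def radicand (ρ : ℝ) (n : ℕ) : ℝ :=
  2 * (1 + ρ) * n - 1 + ρ ^ (2 * n)

theorem radicand_zero (ρ : ℝ) : radicand ρ 0 = 0 := by
  simp [radicand]

theorem radicand_succ (ρ : ℝ) (n : ℕ) :
    radicand ρ (n + 1) = radicand ρ n + (1 + ρ) * (2 - (1 - ρ) * ρ ^ (2 * n)) := by
  simp only [radicand, mul_add, pow_add]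
  push_cast
  ring

theorem radicand_nonneg {ρ : ℝ} (h0 : 0 < ρ) (h1 : ρ < 1) (n : ℕ) : 0 ≤ radicand ρ n := by
  induction n with
  | zero => rw [radicand_zero]
  | succ n ih =>
    have hy : ρ ^ (2 * n) ≤ 1 := pow_le_one₀ h0.le h1.le
    have hy0 : 0 < ρ ^ (2 * n) := pow_pos h0 _
    have h2 : 0 ≤ 2 - (1 - ρ) * ρ ^ (2 * n) := by nlinarith
    rw [radicand_succ]
    positivity

/-- The square root `r n = √(φ n)` of the radicand. -/
noncomputable def root (ρ : ℝ) (n : ℕ) : ℝ := √(radicand ρ n)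

theorem root_nonneg (ρ : ℝ) (n : ℕ) : 0 ≤ root ρ n := Real.sqrt_nonneg _

theorem root_sq {ρ : ℝ} (h0 : 0 < ρ) (h1 : ρ < 1) (n : ℕ) : root ρ n ^ 2 = radicand ρ n :=
  Real.sq_sqrt (radicand_nonneg h0 h1 n)

theorem root_zero (ρ : ℝ) : root ρ 0 = 0 := by
  rw [root, radicand_zero, Real.sqrt_zero]

theorem root_one {ρ : ℝ} (h0 : 0 < ρ) : root ρ 1 = 1 + ρ := by
  rw [root, show radicand ρ 1 = (1 + ρ) ^ 2 by simp [radicand]; ring,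
    Real.sqrt_sq (by positivity)]

/-- Each of the `n + 1` terms of the geometric sum `1 + x + ⋯ + x ^ n` is at least `x ^ n`. -/
theorem succ_mul_pow_mul_one_sub_le {x : ℝ} (h0 : 0 ≤ x) (h1 : x ≤ 1) (n : ℕ) :
    (n + 1) * x ^ n * (1 - x) ≤ 1 - x ^ (n + 1) := by
  induction n with
  | zero => simp
  | succ n ih =>
    have h2 : x ^ (n + 1) ≤ 1 := pow_le_one₀ h0 h1
    have h4 := mul_nonneg (sub_nonneg.2 h1) (sub_nonneg.2 h2)
    push_cast
    calc ((n : ℝ) + 1 + 1) * x ^ (n + 1) * (1 - x)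
        = x * ((n + 1) * x ^ n * (1 - x)) + x ^ (n + 1) * (1 - x) := by ring
      _ ≤ x * (1 - x ^ (n + 1)) + x ^ (n + 1) * (1 - x) := by gcongr
      _ = 1 - x ^ (n + 1 + 1) - (1 - x) * (1 - x ^ (n + 1)) := by ring
      _ ≤ 1 - x ^ (n + 1 + 1) := sub_le_self _ h4

/-- The square roots are strictly concave: although the radicands are convex, their second
differences decay like `ρ ^ (2 n)`, and the slope `≥ (1 + ρ) ^ 2` outweighs them. -/
theorem root_concave {ρ : ℝ} (h0 : 1 / 2 < ρ) (h1 : ρ < 1) (n : ℕ) :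
    root ρ (n + 2) - root ρ (n + 1) < root ρ (n + 1) - root ρ n := by
  have hρ : 0 < ρ := by linarith
  have ha := root_sq hρ h1 n
  have hb := root_sq hρ h1 (n + 1)
  have hc := root_sq hρ h1 (n + 2)
  have e1 := radicand_succ ρ n
  have e2 := radicand_succ ρ (n + 1)
  have hM : radicand ρ (n + 1) = 2 * (1 + ρ) * (n + 1) - 1 + ρ ^ 2 * ρ ^ (2 * n) := by
    simp only [radicand, mul_add, pow_add]; push_cast; ring
  have hpow : ρ ^ (2 * (n + 1)) = ρ ^ 2 * ρ ^ (2 * n) := by ring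
  have hcount : (n + 1) * ρ ^ (2 * n) * (1 - ρ ^ 2) ≤ 1 - ρ ^ 2 * ρ ^ (2 * n) := by
    have := succ_mul_pow_mul_one_sub_le (sq_nonneg ρ) (by nlinarith : ρ ^ 2 ≤ 1) n
    rwa [← pow_mul, ← pow_mul, hpow] at this
  have hy1 : ρ ^ (2 * n) ≤ 1 := pow_le_one₀ hρ.le h1.le
  have hy0 : 0 < ρ ^ (2 * n) := pow_pos hρ _
  have hn : (0 : ℝ) ≤ n := Nat.cast_nonneg n
  rw [hpow] at e2
  generalize ρ ^ (2 * n) = y at *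
  set M := radicand ρ (n + 1)
  have hδ : 0 < 1 - ρ := by linarith
  -- `D` and `D + e` are the first differences of the radicand before and after `n + 1`, where
  -- its value is `M`.
  obtain ⟨D, hD⟩ : ∃ D, D = (1 + ρ) * (2 - (1 - ρ) * y) := ⟨_, rfl⟩
  obtain ⟨e, he⟩ : ∃ e, e = ((1 + ρ) * (1 - ρ)) ^ 2 * y := ⟨_, rfl⟩
  have he0 : 0 ≤ e := by rw [he]; positivity
  have hDlow : (1 + ρ) ^ 2 ≤ D := by
    have : 0 ≤ (1 + ρ) * ((1 - ρ) * (1 - y)) :=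
      mul_nonneg (by linarith) (mul_nonneg hδ.le (by linarith))
    rw [hD]; nlinarith
  have hy2 : ρ ^ 2 * y ≤ 1 := by nlinarith
  -- This bounds `M * e`: the growth of `M`, linear in `n`, is absorbed by `hcount`.
  have hMe : 2 * M * ((1 - ρ) ^ 2 * y) < (1 + ρ) ^ 2 := by
    have h2 := mul_le_mul_of_nonneg_left hcount (by linarith : 0 ≤ 4 * (1 - ρ))
    have h3 : 0 ≤ 2 * (1 - ρ) ^ 2 * y * (1 - ρ ^ 2 * y) :=
      mul_nonneg (by positivity) (by linarith)
    have h4 : 0 ≤ 4 * (1 - ρ) * (ρ ^ 2 * y) := by positivity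
    have h5 : 4 * (1 - ρ) < (1 + ρ) ^ 2 := by nlinarith
    have h6 : 2 * M * ((1 - ρ) ^ 2 * y) = 4 * (1 - ρ) * ((n + 1) * y * (1 - ρ ^ 2))
        - 2 * (1 - ρ) ^ 2 * y * (1 - ρ ^ 2 * y) := by rw [hM]; ring
    linarith
  have hkey : 2 * M * e < (D + e / 2) ^ 2 := by
    calc 2 * M * e = (1 + ρ) ^ 2 * (2 * M * ((1 - ρ) ^ 2 * y)) := by rw [he]; ring
      _ < (1 + ρ) ^ 2 * (1 + ρ) ^ 2 := mul_lt_mul_of_pos_left hMe (by positivity)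
      _ = ((1 + ρ) ^ 2) ^ 2 := by ring
      _ ≤ (D + e / 2) ^ 2 := pow_le_pow_left₀ (by positivity) (by linarith) 2
  have hMe2 : 0 ≤ M - e / 2 := by
    have h2 : e ≤ 1 := by
      have h5 : (1 + ρ) * (1 - ρ) ≤ 1 := by nlinarith
      have h6 : 0 ≤ (1 + ρ) * (1 - ρ) := by positivity
      rw [he]
      exact mul_le_one₀ (pow_le_one₀ h6 h5) hy0.le hy1
    have h3 : 0 ≤ 2 * (1 + ρ) * (n : ℝ) := by positivity
    have h4 : 0 ≤ ρ ^ 2 * y := by positivity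
    rw [hM]
    linarith
  have hA : radicand ρ n = M - D := by linarith
  have hC : radicand ρ (n + 2) = M + D + e := by
    rw [show n + 2 = n + 1 + 1 from rfl, e2, hD, he]; ring
  -- `hkey` is `φ n * φ (n + 2) < (M - e / 2) ^ 2`, since `φ n = M - D` and
  -- `φ (n + 2) = M + D + e`.
  have hprod : root ρ n * root ρ (n + 2) < M - e / 2 := by
    refine lt_of_pow_lt_pow_left₀ 2 hMe2 ?_
    rw [mul_pow, ha, hc, hA, hC]
    nlinarith
  have hsum : root ρ n + root ρ (n + 2) < 2 * root ρ (n + 1) := by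
    refine lt_of_pow_lt_pow_left₀ 2 (mul_nonneg zero_le_two (root_nonneg _ _)) ?_
    rw [mul_pow, hb, add_sq, ha, hc, hA, hC]
    nlinarith
  linarith

/-! ### The explicit solution -/

section Explicit

variable {N : ℕ} {ρ : ℝ}

theorem IsBalancedRoot.half_lt (h : IsBalancedRoot N ρ) (hN : 3 ≤ N) : 1 / 2 < ρ := by
  obtain ⟨h0, h1, h2⟩ := h
  by_contra! hle
  have h3 : ρ ^ (2 * N) ≤ (1 / 2) ^ (2 * N) := pow_le_pow_left₀ h0.le hle _
  have h4 : (3 * (N : ℝ) + 1) < 4 ^ N := by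
    obtain ⟨k, rfl⟩ := Nat.exists_eq_add_of_le hN
    have h5 := one_add_mul_le_pow (by norm_num : (-2 : ℝ) ≤ 3) k
    have h6 : (0 : ℝ) ≤ k := Nat.cast_nonneg k
    norm_num at h5
    rw [pow_add]
    push_cast
    linarith
  have hN0 : (0 : ℝ) ≤ N := Nat.cast_nonneg N
  have h5 : ((1 : ℝ) / 2) ^ (2 * N) * 4 ^ N = 1 := by
    rw [pow_mul, ← mul_pow]; norm_num
  have h6 : ρ ^ (2 * N) * (2 * N * ρ + 2 * N + 1) ≤ (1 / 2) ^ (2 * N) * (3 * N + 1) :=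
    mul_le_mul h3 (by nlinarith) (by positivity) (by positivity)
  have h7 : ((1 : ℝ) / 2) ^ (2 * N) * (3 * N + 1) < (1 / 2) ^ (2 * N) * 4 ^ N :=
    mul_lt_mul_of_pos_left h4 (by positivity)
  linarith

/-- The equation for `ρ` says exactly that `r N = 1 / q - q`, where `q = ρ ^ N`. -/
theorem IsBalancedRoot.pow_mul_root (h : IsBalancedRoot N ρ) :
    ρ ^ N * root ρ N = 1 - (ρ ^ N) ^ 2 := by
  have h0 := h.1
  have hq : ρ ^ N ≤ 1 := pow_le_one₀ h0.le h.2.1.le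
  have hq0 : 0 ≤ ρ ^ N := by positivity
  refine (pow_left_inj₀ (mul_nonneg hq0 (root_nonneg _ _)) (by nlinarith) two_ne_zero).1 ?_
  have h2 := h.2.2
  rw [mul_pow, root_sq h0 h.2.1, radicand]
  rw [mul_comm 2 N, pow_mul] at *
  linear_combination h2

/-- The solution in terms of partial sums: `s 0 = q` and `s i = (r (N - i + 1) - r (N - i)) / α`
for `1 ≤ i ≤ N`. -/
noncomputable def profile (N : ℕ) (ρ : ℝ) (i : ℕ) : ℝ :=
  if i = 0 then ρ ^ N else (root ρ (N - i + 1) - root ρ (N - i)) / (1 + ρ)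

/-- The tail sums `T i = (r (N - i + 1) + ρ r (N - i)) / α`, meaningful for `1 ≤ i ≤ N`. -/
noncomputable def tail (N : ℕ) (ρ : ℝ) (i : ℕ) : ℝ :=
  (root ρ (N - i + 1) + ρ * root ρ (N - i)) / (1 + ρ)

/-- The auxiliary sequence `X i = (ρ ^ (2 (N - 1 - i)) - (s (i + 1)) ^ 2) / 2`. -/
noncomputable def excess (N : ℕ) (ρ : ℝ) (i : ℕ) : ℝ :=
  (ρ ^ (2 * (N - 1 - i)) - profile N ρ (i + 1) ^ 2) / 2

theorem profile_zero : profile N ρ 0 = ρ ^ N := if_pos rfl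

theorem profile_eq (i n : ℕ) (hi : 1 ≤ i) (hn : i + n = N) :
    profile N ρ i = (root ρ (n + 1) - root ρ n) / (1 + ρ) := by
  rw [profile, if_neg (by omega), show N - i = n by omega]

theorem tail_eq (i n : ℕ) (hn : i + n = N) :
    tail N ρ i = (root ρ (n + 1) + ρ * root ρ n) / (1 + ρ) := by
  rw [tail, show N - i = n by omega]

theorem excess_eq (i n : ℕ) (hn : i + n + 1 = N) :
    excess N ρ i = (ρ ^ (2 * n) - ((root ρ (n + 1) - root ρ n) / (1 + ρ)) ^ 2) / 2 := by
  rw [excess, profile_eq (i + 1) n (by omega) (by omega), show N - 1 - i = n by omega]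

theorem profile_top (h0 : 0 < ρ) (hN : 1 ≤ N) : profile N ρ N = 1 := by
  rw [profile_eq N 0 hN (add_zero N), zero_add, root_one h0, root_zero, sub_zero,
    div_self (by positivity)]

/-- With `r` at three consecutive arguments as unknowns, the recursion for `X` and the residual
equations at `i ≥ 1` both reduce to the second difference `φ (n + 2) - 2 φ (n + 1) + φ n`; the
residual equation at `0` reduces to a first difference of `φ` and the value of `r N`. -/
theorem isReducedSolution_profile (h : IsBalancedRoot N ρ) (hN : 3 ≤ N) {d : ℕ → ℝ}
    (hd : ∀ k, k + 2 ≤ N → ρ ^ N * d k = profile N ρ (k + 1) - profile N ρ k) :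
    IsReducedSolution N ρ d (profile N ρ) (tail N ρ) (excess N ρ) := by
  have h0 := h.1
  have hα : 1 + ρ ≠ 0 := by positivity
  have hr : ∀ n, root ρ n ^ 2 = 2 * (1 + ρ) * n - 1 + ρ ^ (2 * n) := root_sq h0 h.2.1
  have hr' : ∀ n : ℕ, root ρ (n + 1) ^ 2 = 2 * (1 + ρ) * (n + 1) - 1 + ρ ^ 2 * ρ ^ (2 * n) :=
    fun n => by rw [hr]; push_cast; ring
  have hr'' : ∀ n : ℕ, root ρ (n + 2) ^ 2 = 2 * (1 + ρ) * (n + 2) - 1 + ρ ^ 4 * ρ ^ (2 * n) :=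
    fun n => by rw [hr]; push_cast; ring
  refine ⟨profile_zero, profile_top h0 (by omega), hd, ?_, ?_, ?_, ?_, ?_, ?_⟩
  · rw [tail_eq N 0 (add_zero N), zero_add, root_one h0, root_zero, mul_zero, add_zero, div_self hα]
  · intro i hi hiN
    obtain ⟨n, rfl⟩ := Nat.exists_eq_add_of_lt hiN
    rw [tail_eq i (n + 1) (by omega), tail_eq (i + 1) n (by omega),
      profile_eq i (n + 1) hi (by omega), profile_eq (i + 1) n (by omega) (by omega)]
    ring
  · rw [excess_eq (N - 1) 0 (by omega), zero_add, root_one h0, root_zero, sub_zero, div_self hα]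
    norm_num
  · intro i hi
    obtain ⟨n, rfl⟩ := Nat.exists_eq_add_of_le hi
    rw [excess_eq i (n + 1) (by omega), excess_eq (i + 1) n (by omega),
      profile_eq (i + 1) (n + 1) (by omega) (by omega),
      profile_eq (i + 2) n (by omega) (by omega), tail_eq (i + 2) n (by omega)]
    have hp : ρ ^ (2 * (n + 1)) = ρ ^ 2 * ρ ^ (2 * n) := by ring
    rw [hp]
    have ea := hr n
    have eb := hr' n
    have ec := hr'' n
    generalize ρ ^ (2 * n) = y at *
    generalize root ρ n = a at *
    generalize root ρ (n + 1) = b at *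
    rw [show n + 1 + 1 = n + 2 from rfl]
    generalize root ρ (n + 2) = c at *
    linear_combination (norm := skip) (-1 / (2 * (1 + ρ))) * (ec - 2 * eb + ea)
    field_simp
    ring
  · rw [excess_eq 0 (N - 1) (by omega), profile_eq 1 (N - 1) le_rfl (by omega), profile_zero,
      tail_eq 1 (N - 1) (by omega)]
    have hq := h.pow_mul_root
    obtain ⟨n, rfl⟩ := Nat.exists_eq_add_of_le (show 1 ≤ N by omega)
    rw [show 1 + n - 1 = n by omega]
    rw [add_comm 1 n] at *
    have hp : (ρ ^ (n + 1)) ^ 2 = ρ ^ 2 * ρ ^ (2 * n) := by ring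
    have ea := hr n
    have eb := hr' n
    generalize ρ ^ (n + 1) = q at *
    generalize ρ ^ (2 * n) = y at *
    generalize root ρ n = a at *
    generalize root ρ (n + 1) = b at *
    linear_combination (norm := skip) (1 / (2 * (1 + ρ))) * (eb - ea) - hq
    field_simp
    ring
  · intro i hi
    obtain ⟨n, rfl⟩ := Nat.exists_eq_add_of_le (show i + 2 ≤ N by omega)
    rw [excess_eq i (n + 1) (by omega), excess_eq (i + 1) n (by omega),
      profile_eq (i + 1) (n + 1) (by omega) (by omega),
      profile_eq (i + 2) n (by omega) (by omega), tail_eq (i + 2) n (by omega)]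
    have hp : ρ ^ (2 * (n + 1)) = ρ ^ 2 * ρ ^ (2 * n) := by ring
    rw [hp]
    have ea := hr n
    have eb := hr' n
    have ec := hr'' n
    generalize ρ ^ (2 * n) = y at *
    generalize root ρ n = a at *
    generalize root ρ (n + 1) = b at *
    rw [show n + 1 + 1 = n + 2 from rfl]
    generalize root ρ (n + 2) = c at *
    linear_combination (norm := skip) (-1 / (2 * (1 + ρ))) * (ec - 2 * eb + ea)
    field_simp
    ring

theorem profile_lt_succ (h : IsBalancedRoot N ρ) (hN : 3 ≤ N) (i : ℕ) (hi : i < N) :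
    profile N ρ i < profile N ρ (i + 1) := by
  have h0 := h.1
  have hhalf := h.half_lt hN
  have hα : 0 < 1 + ρ := by positivity
  cases i with
  | succ i =>
    obtain ⟨n, rfl⟩ := Nat.exists_eq_add_of_lt hi
    rw [profile_eq (i + 1) (n + 1) (by omega) (by omega),
      profile_eq (i + 1 + 1) n (by omega) (by omega)]
    exact div_lt_div_of_pos_right (root_concave hhalf h.2.1 n) hα
  | zero =>
    have hq := h.pow_mul_root
    have hbal := h.2.2
    obtain ⟨n, rfl⟩ := Nat.exists_eq_add_of_le' (show 1 ≤ N by omega)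
    rw [profile_zero, zero_add, profile_eq 1 n le_rfl (by omega), lt_div_iff₀ hα]
    have hq0 : 0 < ρ ^ (n + 1) := pow_pos h0 _
    have hp : (ρ ^ (n + 1)) ^ 2 = ρ ^ 2 * ρ ^ (2 * n) := by ring
    have hp' : ρ ^ (2 * (n + 1)) = (ρ ^ (n + 1)) ^ 2 := by ring
    have ha : root ρ n ^ 2 = 2 * (1 + ρ) * n - 1 + ρ ^ (2 * n) := root_sq h0 h.2.1 n
    have hn : (2 : ℝ) ≤ n := by exact_mod_cast (by omega : 2 ≤ n)
    rw [hp'] at hbal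
    push_cast at hbal
    have hy0 : 0 < ρ ^ (2 * n) := pow_pos h0 _
    generalize ρ ^ (n + 1) = q at *
    generalize ρ ^ (2 * n) = y at *
    have h1 := h.2.1
    -- After multiplication by `q` the claim is `q * r (N - 1) < 1 - (2 + ρ) * q ^ 2`.
    have hpos : 0 ≤ 1 - (2 + ρ) * q ^ 2 := by
      have h2 : 2 + ρ ≤ 2 * (n + 1) * ρ + 2 * (n + 1) + 1 := by nlinarith
      have h3 := mul_le_mul_of_nonneg_left h2 (sq_nonneg q)
      linarith
    have hlt : q * root ρ n < 1 - (2 + ρ) * q ^ 2 := by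
      refine lt_of_pow_lt_pow_left₀ 2 hpos ?_
      have h2 : y < (2 + ρ) ^ 2 * q ^ 2 := by
        have h3 : 1 < (2 + ρ) * ρ := by nlinarith
        have h4 : 1 < ((2 + ρ) * ρ) ^ 2 := one_lt_pow₀ h3 two_ne_zero
        rw [hp]
        linarith [mul_lt_mul_of_pos_right h4 hy0]
      have h5 := mul_lt_mul_of_pos_left h2 (pow_pos hq0 2)
      rw [mul_pow, ha]
      linarith
    have : q * (q * (1 + ρ)) < q * (root ρ (n + 1) - root ρ n) := by
      rw [mul_sub, hq]; nlinarith
    exact lt_of_mul_lt_mul_left this hq0.le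

end Explicit

end GSW

theorem mainTheorem5 (N : ℕ) (hN : 3 ≤ N) :
    ∃ d : Fin (N - 1) → ℝ,
      (∀ i, 0 < d i) ∧ ∑ i, d i < 2 * (N : ℝ) ∧ GSW.reducedResidual N d = 0 := by
  have h := GSW.isBalancedRoot_balancedRoot N (by omega)
  set ρ := GSW.balancedRoot N with hρ
  have hq0 : 0 < ρ ^ N := pow_pos h.1 N
  have hmono := GSW.profile_lt_succ h hN
  let d : Fin (N - 1) → ℝ := fun i => (GSW.profile N ρ (i + 1) - GSW.profile N ρ i) / ρ ^ N
  have hext : ∀ k, (hk : k < N - 1) → GSW.extendZero d k = d ⟨k, hk⟩ := fun k hk => dif_pos hk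
  have hsol := GSW.isReducedSolution_profile h hN (d := GSW.extendZero d) fun k hk => by
    rw [hext k (by omega), mul_div_cancel₀ _ hq0.ne']
  refine ⟨d, fun i => div_pos (sub_pos.2 (hmono i (by omega))) hq0, ?_,
    funext fun i => hsol.residual_eq_zero h.1 i (by omega)⟩
  have hsum : ∑ i, d i = ∑ k ∈ Finset.range (N - 1), GSW.extendZero d k := by
    rw [Finset.sum_range]
    exact Finset.sum_congr rfl fun i _ => (hext i i.2).symm
  have htot := hsol.sum_range (N - 1) (by omega)
  have hlast := hmono (N - 1) (by omega)
  rw [show N - 1 + 1 = N by omega, GSW.profile_top h.1 (by omega), ← htot, ← hsum] at hlast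
  have hN' : (3 : ℝ) ≤ N := by exact_mod_cast hN
  have hbound : 1 < ρ ^ N * (2 * N + 1) := by
    refine lt_of_pow_lt_pow_left₀ 2 (by positivity) ?_
    have h2 := h.2.2
    have h1 := h.2.1
    rw [mul_comm 2 N, pow_mul] at h2
    rw [one_pow, mul_pow, ← h2]
    exact mul_lt_mul_of_pos_left (by nlinarith) (by positivity)
  have := lt_of_mul_lt_mul_left (hlast.trans hbound) hq0.le
  linarith
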